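/- Let $N_t,N_m\ge 1$ and $0\le N_e<N_t$ be integers, let $\eta>0$, and put $m=\min(N_t-N_e,N_m)$, $k=\max(N_t-N_e,N_m)$. Let $\mathbf H_m\in\mathbb C^{N_m\times N_t}$ and $\mathbf H_e\in\mathbb C^{N_e\times N_t}$ be random matrices all of whose entries are independent circularly symmetric complex Gaussian variables with mean $0$ and variance $1$. Let $A$ be an $N_t\times(N_t-N_e)$ matrix, depending on the channel realization, whose columns are almost surely an orthonormal basis of the null space of $\mathbf H_e$. Let $g=\mathbb E\big[\lambda_{\max}(\mathbf H_m^\dagger\mathbf H_m-\mathbf H_e^\dagger\mathbf H_e)^+\big]$ be the array gain (a nonnegative number) or, more generally, let $g\ge 0$ be any real number. For $r_s\ge 0$ let $R_s=r_s\log(1+g\eta)$ be the secrecy rate with multiplexing gain $r_s$, and let the zero-forcing secrecy outage probability be $$P_{out}^{ZF}=P\Big[\log\det\Big(I+\frac{\eta}{N_t-N_e}\,\mathbf H_{eq}\mathbf H_{eq}^\dagger\Big)<R_s\Big],\qquad \mathbf H_{eq}=\mathbf H_mA .$$ Then, for all real numbers $a_1\ge a_2\ge\dots\ge a_m\ge 0$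 with $\sum_{l=1}^m a_l=r_s$, $$P_{out}^{ZF}\ \ge\ \prod_{l=1}^m\Gamma_{inc}\big(\xi(a_l),\,k+m-2l+1\big),$$ where $\Gamma_{inc}(x,a)=\frac1{(a-1)!}\int_0^x t^{a-1}e^{-t}\,dt$ and $\xi(x)=\frac{N_t-N_e}{\eta}\big((1+g\eta)^x-1\big)$. -/

import Mathlib

open MeasureTheory ProbabilityTheory
open scoped Matrix

namespace ZFSecrecy

noncomputable section

/-- The standard circularly symmetric complex Gaussian law `CN(0, 1)`: independent real and imaginary
parts, each centred Gaussian with variance `1/2`. -/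
def stdComplexGaussian : Measure ℂ :=
  ((gaussianReal 0 (1 / 2)).prod (gaussianReal 0 (1 / 2))).map
    (fun p : ℝ × ℝ => (⟨p.1, p.2⟩ : ℂ))

/-- Fading model of the wiretap channel: all the entries of the main channel `Hm` and of the
eavesdropper channel `He` together are independent, each with law `CN(0, 1)`. -/
structure IsRayleighFading {Ω : Type*} [MeasurableSpace Ω] (P : Measure Ω) {Nt Nm Ne : ℕ}
    (Hm : Ω → Matrix (Fin Nm) (Fin Nt) ℂ) (He : Ω → Matrix (Fin Ne) (Fin Nt) ℂ) : Prop where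
  law_main : ∀ i j, HasLaw (fun ω => Hm ω i j) stdComplexGaussian P
  law_eve : ∀ i j, HasLaw (fun ω => He ω i j) stdComplexGaussian P
  indep : iIndepFun
    (fun (x : (Fin Nm ⊕ Fin Ne) × Fin Nt) (ω : Ω) =>
      Sum.elim (fun i => Hm ω i x.2) (fun i => He ω i x.2) x.1) P

/-- `A` is a zero-forcing precoder for the eavesdropper channel `He`: its `Nt - Ne` columns are
orthonormal and lie in the null space of `He`. When `He` has full row rank `Ne` (almost surely under
fading), this says that they are an orthonormal basis of that null space, i.e. that `A * Aᴴ` is the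
orthogonal projection onto it. -/
structure IsZFPrecoder {Nt Ne : ℕ} (He : Matrix (Fin Ne) (Fin Nt) ℂ)
    (A : Matrix (Fin Nt) (Fin (Nt - Ne)) ℂ) : Prop where
  null : He * A = 0
  orthonormal : Aᴴ * A = 1

/-- `Ψ(H) = log det (I + η / n • H Hᴴ)` for a channel matrix `H` with `n` transmit antennas. The
determinant is that of a positive definite Hermitian matrix, hence a positive real number. -/
def mutualInfo {r n : ℕ} (η : ℝ) (H : Matrix (Fin r) (Fin n) ℂ) : ℝ :=
  Real.log (Matrix.det (1 + ((η / n : ℝ) : ℂ) • (H * Hᴴ))).re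

/-- The zero-forcing secrecy outage probability at SNR `η` and secrecy rate `Rs` (in nats): the
probability that the equivalent channel `Hm * A` does not support the rate `Rs`. -/
def outageZF {Ω : Type*} [MeasurableSpace Ω] (P : Measure Ω) {Nt Nm Ne : ℕ}
    (Hm : Ω → Matrix (Fin Nm) (Fin Nt) ℂ) (A : Ω → Matrix (Fin Nt) (Fin (Nt - Ne)) ℂ)
    (η Rs : ℝ) : ℝ :=
  P.real {ω | mutualInfo η (Hm ω * A ω) < Rs}

/-- The array gain: the expectation of the positive part of the largest eigenvalue of
the Hermitian matrix `Hmᴴ Hm - Heᴴ He`. -/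
def arrayGain {Ω : Type*} [MeasurableSpace Ω] (P : Measure Ω) {Nt Nm Ne : ℕ}
    (Hm : Ω → Matrix (Fin Nm) (Fin Nt) ℂ) (He : Ω → Matrix (Fin Ne) (Fin Nt) ℂ) : ℝ :=
  ∫ ω, max (sSup (spectrum ℝ ((Hm ω)ᴴ * Hm ω - (He ω)ᴴ * He ω))) 0 ∂P

/-- The secrecy rate `Rs` whose secrecy multiplexing gain `Rs / log (1 + g η)` is `rs`. -/
def secrecyRate (g η rs : ℝ) : ℝ := rs * Real.log (1 + g * η)

/-- The regularized incomplete Gamma function, for an integer parameter `a ≥ 1`. -/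
def gammaInc (x : ℝ) (a : ℕ) : ℝ :=
  1 / ((a - 1).factorial : ℝ) * ∫ t in (0 : ℝ)..x, t ^ (a - 1) * Real.exp (-t)

/-- `ξ(x) = (Nt - Ne) / η * ((1 + g η) ^ x - 1)`. -/
def xi (Nt Ne : ℕ) (g η x : ℝ) : ℝ :=
  ((Nt : ℝ) - (Ne : ℝ)) / η * ((1 + g * η) ^ x - 1)

end

end ZFSecrecy

namespace ZFSecrecy

/-! Almost surely `A * Aᴴ` is the projection onto the null space of `He`, so the outage event
depends on the channels alone. For fixed `He`, unitary invariance makes `Hm * A` an `Nm × (Nt - Ne)`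
matrix of independent CN(0, 1) entries. It remains to bound P[det(I + ρ H Hᴴ) < exp Rs] from below
for a Gaussian r × n matrix `H`, with ρ = η / (Nt - Ne).

A unitary acting on the columns leaves the determinant unchanged and turns the first row into a
vector supported on its first entry; the other rows stay Gaussian and independent of that row.
Fischer's inequality then gives det ≤ (1 + ρ X) det', where X is the squared norm of the rotated
first column and det' belongs to the remaining (r - 1) × (n - 1) Gaussian block, independent of X.
As X sums the squared moduli of r + n - 1 independent entries, it is Gamma(r + n - 1) distributed.
This is `gammaInc_mul_gramDet_le`, and it is iterated.

Since exp Rs = ∏ (1 + gη)^(a l), it suffices that the l-th factor 1 + ρ X_l lies below (1 + gη)^(a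
l), that is X_l < ξ(a l). The probabilities of these independent events multiply to the bound. -/

/-! ### Complex Gaussian vectors and their unitary invariance -/

instance : IsProbabilityMeasure stdComplexGaussian :=
  Measure.isProbabilityMeasure_map
    (Complex.measurableEquivRealProd.symm.measurable.aemeasurable (f := fun p : ℝ × ℝ => (⟨p.1, p.2⟩ : ℂ)))

theorem measurable_complex_mk : Measurable (fun p : ℝ × ℝ => (⟨p.1, p.2⟩ : ℂ)) :=
  Complex.measurableEquivRealProd.symm.measurable

theorem strongDual_complex_apply (L : StrongDual ℝ ℂ) (z : ℂ) :
    L z = z.re * L 1 + z.im * L Complex.I := by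
  conv_lhs => rw [← Complex.re_add_im z]
  have h1 : (z.re : ℂ) = z.re • (1 : ℂ) := by simp
  have h2 : (z.im : ℂ) * Complex.I = z.im • Complex.I := by simp
  rw [map_add, h1, h2, map_smul, map_smul, smul_eq_mul, smul_eq_mul]

theorem charFunDual_stdComplexGaussian (L : StrongDual ℝ ℂ) :
    charFunDual stdComplexGaussian L =
      Complex.exp (-(((L 1) ^ 2 + (L Complex.I) ^ 2) / 4 : ℝ)) := by
  rw [charFunDual_apply, stdComplexGaussian,
    integral_map measurable_complex_mk.aemeasurable (by fun_prop)]
  have : ∀ p : ℝ × ℝ, Complex.exp ((L ⟨p.1, p.2⟩ : ℂ) * Complex.I) =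
      Complex.exp ((L 1 : ℂ) * p.1 * Complex.I) *
        Complex.exp ((L Complex.I : ℂ) * p.2 * Complex.I) := by
    intro p
    rw [strongDual_complex_apply, ← Complex.exp_add]
    push_cast
    ring_nf
  simp_rw [this]
  rw [integral_prod_mul (fun x : ℝ => Complex.exp ((L 1 : ℂ) * x * Complex.I))
    (fun x : ℝ => Complex.exp ((L Complex.I : ℂ) * x * Complex.I)),
    ← charFun_apply_real, ← charFun_apply_real, charFun_gaussianReal, charFun_gaussianReal,
    ← Complex.exp_add]
  congr 1
  push_cast
  ring

/-- The law of a vector of independent `CN(0, 1)` entries. -/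
noncomputable def complexGaussianVec (ι : Type*) [Fintype ι] : Measure (ι → ℂ) :=
  Measure.pi fun _ => stdComplexGaussian

/-- The law of a matrix of independent `CN(0, 1)` entries. -/
noncomputable def complexGaussianMat (ι κ : Type*) [Fintype ι] [Fintype κ] : Measure (ι → κ → ℂ) :=
  Measure.pi fun _ => complexGaussianVec κ

instance (ι : Type*) [Fintype ι] : IsProbabilityMeasure (complexGaussianVec ι) := by
  unfold complexGaussianVec; infer_instance

instance (ι κ : Type*) [Fintype ι] [Fintype κ] :
    IsProbabilityMeasure (complexGaussianMat ι κ) := by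
  unfold complexGaussianMat; infer_instance

/-- A real functional on ℂ^ι has the form z ↦ Re ∑ z_i c_i with c_i = L(e_i) - i L(i e_i). The
characteristic function sees only the norm of c, which is what yields unitary invariance. -/
theorem charFunDual_complexGaussianVec {ι : Type*} [Fintype ι] [DecidableEq ι]
    (L : StrongDual ℝ (ι → ℂ)) :
    charFunDual (complexGaussianVec ι) L = Complex.exp (-((∑ i,
      ‖(L (Pi.single i 1) : ℂ) - L (Pi.single i Complex.I) * Complex.I‖ ^ 2) / 4 : ℝ)) := by
  rw [complexGaussianVec, charFunDual_pi]
  simp_rw [charFunDual_stdComplexGaussian, ← Complex.exp_sum]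
  congr 1
  rw [Finset.sum_neg_distrib, Finset.sum_div]
  push_cast
  congr 1
  refine Finset.sum_congr rfl fun i _ => ?_
  norm_cast
  rw [← Complex.normSq_eq_norm_sq]
  simp [Complex.normSq_apply]
  ring

theorem strongDual_vec_apply {κ : Type*} [Fintype κ] [DecidableEq κ]
    (L : StrongDual ℝ (κ → ℂ)) (z : κ → ℂ) :
    L z = (∑ j, z j * ((L (Pi.single j 1) : ℂ) - L (Pi.single j Complex.I) * Complex.I)).re := by
  conv_lhs => rw [← Finset.univ_sum_single z]
  rw [map_sum, Complex.re_sum]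
  refine Finset.sum_congr rfl fun j _ => ?_
  have := strongDual_complex_apply (L.comp (ContinuousLinearMap.single ℝ (fun _ : κ => ℂ) j)) (z j)
  simp at this
  rw [this]
  simp

theorem sum_norm_sq_mulVec {ι κ : Type*} [Fintype ι] [Fintype κ] [DecidableEq κ]
    {A : Matrix ι κ ℂ} (hA : Aᴴ * A = 1) (c : κ → ℂ) :
    ∑ i, ‖(A *ᵥ c) i‖ ^ 2 = ∑ j, ‖c j‖ ^ 2 := by
  have key : ∀ {ι : Type _} [Fintype ι] (v : ι → ℂ), ((∑ i, ‖v i‖ ^ 2 : ℝ) : ℂ) = star v ⬝ᵥ v := by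
    intro ι _ v
    simp [dotProduct, Complex.conj_mul']
  have : ((∑ i, ‖(A *ᵥ c) i‖ ^ 2 : ℝ) : ℂ) = ((∑ j, ‖c j‖ ^ 2 : ℝ) : ℂ) := by
    have k2 : ((∑ j, ‖c j‖ ^ 2 : ℝ) : ℂ) = star c ⬝ᵥ c := by
      simp [dotProduct, Complex.conj_mul']
    rw [key, k2, Matrix.star_mulVec, Matrix.dotProduct_mulVec, Matrix.vecMul_vecMul, hA,
      Matrix.vecMul_one]
  exact_mod_cast this

/-- The complex Gaussian law is preserved by a matrix with orthonormal columns. -/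
theorem complexGaussianVec_map_vecMul {ι κ : Type*} [Fintype ι] [Fintype κ] [DecidableEq κ]
    {A : Matrix ι κ ℂ} (hA : Aᴴ * A = 1) :
    (complexGaussianVec ι).map (fun z => z ᵥ* A) = complexGaussianVec κ := by
  classical
  let T : (ι → ℂ) →L[ℝ] (κ → ℂ) :=
    LinearMap.toContinuousLinearMap ((Matrix.vecMulLinear A).restrictScalars ℝ)
  have hT : ∀ z, T z = z ᵥ* A := fun z => rfl
  have : (complexGaussianVec ι).map (fun z => z ᵥ* A) = (complexGaussianVec ι).map T := rfl
  rw [this]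
  have : IsProbabilityMeasure ((complexGaussianVec ι).map T) :=
    Measure.isProbabilityMeasure_map T.continuous.measurable.aemeasurable
  apply Measure.ext_of_charFunDual
  ext L
  rw [charFunDual_map, charFunDual_complexGaussianVec, charFunDual_complexGaussianVec,
    ← sum_norm_sq_mulVec hA]
  congr 4
  refine Finset.sum_congr rfl fun i _ => ?_
  congr 2
  -- Pulling `L` back along z ↦ z A replaces its coefficient vector c by A c, of the same norm.
  have h1 : ∀ z : ℂ, (L.comp T) (Pi.single i z) = (z * (A *ᵥ fun j =>
      ((L (Pi.single j 1) : ℂ) - L (Pi.single j Complex.I) * Complex.I)) i).re := by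
    intro z
    rw [ContinuousLinearMap.comp_apply, hT, strongDual_vec_apply]
    simp [Matrix.mulVec, dotProduct, Finset.mul_sum, mul_assoc]
  rw [h1, h1]
  apply Complex.ext <;> simp

theorem measurable_vecMul {ι κ : Type*} [Fintype ι] [Fintype κ] (A : Matrix ι κ ℂ) :
    Measurable (fun z : ι → ℂ => z ᵥ* A) := by
  unfold Matrix.vecMul dotProduct
  fun_prop

theorem measurePreserving_matMul {r ι κ : Type*} [Fintype r] [Fintype ι] [Fintype κ]
    [DecidableEq κ] {A : Matrix ι κ ℂ} (hA : Aᴴ * A = 1) :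
    MeasurePreserving (fun (H : r → ι → ℂ) i => H i ᵥ* A) (complexGaussianMat r ι)
      (complexGaussianMat r κ) :=
  measurePreserving_pi _ _ fun _ => ⟨measurable_vecMul A, complexGaussianVec_map_vecMul hA⟩

/-! ### Gamma law of the squared norm -/

/-- The squared modulus of a CN(0, 1) variable is Exp(1): in polar coordinates the density is π⁻¹
exp(-r²), the angle contributes 2π, and t = r² absorbs the remaining 2r dr. -/
theorem lintegral_normSq_stdComplexGaussian (f : ℝ → ENNReal) (hf : Measurable f) :
    ∫⁻ z, f (Complex.normSq z) ∂stdComplexGaussian =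
      ∫⁻ t in Set.Ioi (0 : ℝ), ENNReal.ofReal (Real.exp (-t)) * f t := by
  have hm : Measurable fun z : ℂ => f (Complex.normSq z) :=
    hf.comp Complex.continuous_normSq.measurable
  rw [stdComplexGaussian, lintegral_map hm measurable_complex_mk,
    gaussianReal_of_var_ne_zero _ (by norm_num),
    prod_withDensity (by fun_prop) (by fun_prop), lintegral_withDensity_eq_lintegral_mul₀
      (g := fun a : ℝ × ℝ => f (Complex.normSq ⟨a.1, a.2⟩))
      (by fun_prop) (hm.comp measurable_complex_mk).aemeasurable, ← Measure.volume_eq_prod,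
    ← lintegral_comp_polarCoord_symm]
  have h1 : ∀ p ∈ polarCoord.target, ENNReal.ofReal p.1 •
      ((fun z : ℝ × ℝ => gaussianPDF 0 (1 / 2) z.1 * gaussianPDF 0 (1 / 2) z.2) *
        fun a : ℝ × ℝ => f (Complex.normSq ⟨a.1, a.2⟩)) (polarCoord.symm p) =
      (fun r : ℝ => ENNReal.ofReal (r * (Real.pi⁻¹ * Real.exp (-r ^ 2))) * f (r ^ 2)) p.1 *
        (fun _ => 1) p.2 := by
    rintro ⟨r, θ⟩ hp
    have hr : 0 ≤ r := by simpa using hp.1.le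
    have e1 : r * Real.cos θ * (r * Real.cos θ) + r * Real.sin θ * (r * Real.sin θ) = r ^ 2 := by
      linear_combination r ^ 2 * Real.sin_sq_add_cos_sq θ
    simp only [polarCoord_symm_apply, Pi.mul_apply, gaussianPDF, smul_eq_mul, mul_one]
    rw [Complex.normSq_apply]
    dsimp only
    rw [e1, ← mul_assoc, ← ENNReal.ofReal_mul (gaussianPDFReal_nonneg _ _ _),
      ← ENNReal.ofReal_mul hr]
    congr 3
    simp only [gaussianPDFReal]
    rw [mul_mul_mul_comm, ← Real.exp_add, ← mul_inv, Real.mul_self_sqrt (by positivity)]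
    congr 2
    · push_cast; ring
    · push_cast; rw [← e1]; ring
  rw [setLIntegral_congr_fun polarCoord.open_target.measurableSet h1, polarCoord_target,
    Measure.volume_eq_prod, ← Measure.prod_restrict,
    lintegral_prod_mul (f := fun r : ℝ => ENNReal.ofReal (r * (Real.pi⁻¹ * Real.exp (-r ^ 2))) *
      f (r ^ 2)) (g := fun _ => 1) (by fun_prop) (by fun_prop)]
  have himg : (fun r : ℝ => r ^ 2) '' Set.Ioi 0 = Set.Ioi 0 := by
    ext t
    constructor
    · rintro ⟨r, hr, rfl⟩
      exact pow_pos (Set.mem_Ioi.1 hr) 2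
    · intro ht
      exact ⟨√t, Real.sqrt_pos.2 ht, Real.sq_sqrt (le_of_lt ht)⟩
  conv_rhs => rw [← himg]
  rw [lintegral_image_eq_lintegral_abs_deriv_mul measurableSet_Ioi
    (fun r _ => (hasDerivAt_pow 2 r).hasDerivWithinAt)
    (fun x hx y hy h => (pow_left_inj₀ (le_of_lt hx) (le_of_lt hy) two_ne_zero).1 h),
    ← lintegral_mul_const _ (by fun_prop)]
  refine setLIntegral_congr_fun measurableSet_Ioi fun r hr => ?_
  have hr : 0 < r := hr
  simp only [lintegral_const, MeasurableSet.univ, Measure.restrict_apply, Set.univ_inter,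
    Real.volume_Ioo, one_mul]
  rw [mul_right_comm, ← ENNReal.ofReal_mul (by positivity), ← mul_assoc (ENNReal.ofReal |_|),
    ← ENNReal.ofReal_mul (by positivity)]
  congr 2
  rw [abs_of_pos (by positivity)]
  field_simp
  simp
  ring

/-- The Taylor polynomial `∑ i < n, t ^ i / i!` of the exponential. -/
noncomputable def expSum (n : ℕ) (t : ℝ) : ℝ := ∑ i ∈ Finset.range n, t ^ i / i.factorial

theorem hasDerivAt_expSum (n : ℕ) (t : ℝ) : HasDerivAt (expSum (n + 1)) (expSum n t) t := by
  induction n with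
  | zero =>
    have : expSum 1 = fun _ => (1 : ℝ) := by ext; simp [expSum]
    simpa [this, expSum] using hasDerivAt_const t (1 : ℝ)
  | succ n ih =>
    have h : expSum (n + 1 + 1) = fun t => expSum (n + 1) t + t ^ (n + 1) / (n + 1).factorial := by
      ext; simp [expSum, Finset.sum_range_succ]
    have h2 : expSum (n + 1) t = expSum n t + (↑(n + 1) * t ^ n) / (n + 1).factorial := by
      simp only [expSum, Finset.sum_range_succ, Nat.factorial_succ, Nat.cast_mul]
      congr 1
      rw [mul_div_mul_left]
      positivity
    rw [h, h2]
    exact ih.add ((hasDerivAt_pow (n + 1) t).div_const _)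

theorem continuous_expSum (n : ℕ) : Continuous (expSum n) := by
  unfold expSum; fun_prop

theorem expSum_succ_zero (n : ℕ) : expSum (n + 1) 0 = 1 := by
  simp [expSum, Finset.sum_range_succ']

theorem exp_neg_mul_expSum_le_one (n : ℕ) {t : ℝ} (ht : 0 ≤ t) :
    Real.exp (-t) * expSum n t ≤ 1 := by
  have := mul_le_mul_of_nonneg_left (Real.sum_le_exp_of_nonneg ht n) (Real.exp_pos (-t)).le
  rwa [← Real.exp_add, neg_add_cancel, Real.exp_zero] at this

/-- The derivative of -exp(-t) ∑_{i ≤ n} t^i / i! telescopes to the Gamma density. -/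
theorem gammaInc_succ (x : ℝ) (n : ℕ) :
    gammaInc x (n + 1) = 1 - Real.exp (-x) * expSum (n + 1) x := by
  have hd : ∀ t ∈ Set.uIcc 0 x, HasDerivAt (fun t => -(Real.exp (-t) * expSum (n + 1) t))
      (t ^ n * Real.exp (-t) / n.factorial) t := by
    intro t _
    have := (((hasDerivAt_neg t).exp).mul (hasDerivAt_expSum n t)).neg
    refine this.congr_deriv ?_
    have h2 : expSum (n + 1) t = expSum n t + t ^ n / n.factorial := by
      simp [expSum, Finset.sum_range_succ]
    rw [h2]
    ring
  have := intervalIntegral.integral_eq_sub_of_hasDerivAt hd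
    (Continuous.intervalIntegrable (by fun_prop) _ _)
  rw [intervalIntegral.integral_div] at this
  rw [gammaInc, Nat.add_sub_cancel, one_div_mul_eq_div, this, expSum_succ_zero]
  simp
  ring

/-- Convolution with Exp(1) raises the Gamma parameter by one. The case n = 0 is the point mass at
0, as `expSum 0` vanishes. -/
theorem lintegral_exp_mul_gammaTail (n : ℕ) {s : ℝ} (hs : 0 < s) :
    ∫⁻ t in Set.Ioi (0 : ℝ), ENNReal.ofReal (Real.exp (-t)) * (if 0 < s - t then
      ENNReal.ofReal (1 - Real.exp (-(s - t)) * expSum n (s - t)) else 0) =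
      ENNReal.ofReal (1 - Real.exp (-s) * expSum (n + 1) s) := by
  have h0 : ∀ t : ℝ, ENNReal.ofReal (Real.exp (-t)) * (if 0 < s - t then
      ENNReal.ofReal (1 - Real.exp (-(s - t)) * expSum n (s - t)) else 0) =
      (Set.Iio s).indicator (fun t => ENNReal.ofReal
        (Real.exp (-t) * (1 - Real.exp (-(s - t)) * expSum n (s - t)))) t := by
    intro t
    by_cases h : t < s
    · rw [if_pos (by linarith), Set.indicator_of_mem (by exact h),
        ENNReal.ofReal_mul (Real.exp_pos _).le]
    · rw [if_neg (by linarith), Set.indicator_of_notMem (by exact h), mul_zero]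
  have hc : Continuous fun t =>
      Real.exp (-t) * (1 - Real.exp (-(s - t)) * expSum n (s - t)) := by
    have := continuous_expSum n
    fun_prop
  simp_rw [h0]
  rw [setLIntegral_indicator measurableSet_Iio, Set.inter_comm, Set.Ioi_inter_Iio,
    Measure.restrict_congr_set Ioo_ae_eq_Ioc,
    ← ofReal_integral_eq_lintegral_ofReal
      ((hc.integrableOn_Icc (a := 0) (b := s)).mono_set Set.Ioc_subset_Icc_self),
    ← intervalIntegral.integral_of_le hs.le]
  · congr 1
    have hd : ∀ t ∈ Set.uIcc 0 s, HasDerivAt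
        (fun t => -Real.exp (-t) + Real.exp (-s) * expSum (n + 1) (s - t))
        (Real.exp (-t) * (1 - Real.exp (-(s - t)) * expSum n (s - t))) t := by
      intro t _
      have h1 := ((hasDerivAt_neg t).exp).neg
      have h2 := ((hasDerivAt_expSum n (s - t)).comp t
        ((hasDerivAt_id t).const_sub s)).const_mul (Real.exp (-s))
      refine (h1.add h2).congr_deriv ?_
      have : Real.exp (-s) = Real.exp (-t) * Real.exp (-(s - t)) := by
        rw [← Real.exp_add]; congr 1; ring
      rw [this]
      ring
    rw [intervalIntegral.integral_eq_sub_of_hasDerivAt hd (hc.intervalIntegrable _ _), sub_self,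
      expSum_succ_zero]
    simp
    ring
  · filter_upwards [ae_restrict_mem measurableSet_Ioc] with t ht
    have := exp_neg_mul_expSum_le_one n (sub_nonneg.2 ht.2)
    exact mul_nonneg (Real.exp_pos _).le (by simpa using this)

theorem measurable_sum_normSq {ι : Type*} [Fintype ι] :
    Measurable fun z : ι → ℂ => ∑ i, Complex.normSq (z i) := by
  have := Complex.continuous_normSq
  fun_prop

/-- Induction on n, conditioning on the first coordinate, whose squared modulus is Exp(1). The
branch s ≤ 0 is needed because the conditional threshold s - |z₀|² can be negative. -/
theorem complexGaussianVec_fin_sum_normSq_lt (n : ℕ) (s : ℝ) :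
    complexGaussianVec (Fin n) {z | ∑ i, Complex.normSq (z i) < s} =
      if 0 < s then ENNReal.ofReal (1 - Real.exp (-s) * expSum n s) else 0 := by
  induction n generalizing s with
  | zero => by_cases h : 0 < s <;> simp [h, expSum]
  | succ n ih =>
    have hmp := (measurePreserving_piFinSuccAbove (fun _ : Fin (n + 1) => stdComplexGaussian) 0).symm
    have hset : MeasurableSet {z : Fin (n + 1) → ℂ | ∑ i, Complex.normSq (z i) < s} :=
      measurableSet_lt measurable_sum_normSq measurable_const
    have h1 := hmp.measure_preimage hset.nullMeasurableSet
    have h2 : (MeasurableEquiv.piFinSuccAbove (fun _ : Fin (n + 1) => ℂ) 0).symm ⁻¹'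
        {z | ∑ i, Complex.normSq (z i) < s} =
        {p | ∑ i, Complex.normSq (p.2 i) < s - Complex.normSq p.1} := by
      ext p
      simp [MeasurableEquiv.piFinSuccAbove, Fin.sum_univ_succ, lt_sub_iff_add_lt, add_comm]
    unfold complexGaussianVec at ih ⊢
    rw [← h1, h2, Measure.prod_apply (by
      have := measurable_sum_normSq (ι := Fin n)
      have := Complex.continuous_normSq
      exact measurableSet_lt (by fun_prop) (by fun_prop))]
    have h3 : ∀ z : ℂ, (Measure.pi fun _ : Fin n => stdComplexGaussian)
        (Prod.mk z ⁻¹' {p : ℂ × (Fin n → ℂ) |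
          ∑ i, Complex.normSq (p.2 i) < s - Complex.normSq p.1}) =
        (fun t : ℝ => if 0 < s - t then
          ENNReal.ofReal (1 - Real.exp (-(s - t)) * expSum n (s - t)) else 0)
          (Complex.normSq z) := by
      intro z
      exact (congrArg _ (by ext; simp)).trans (ih (s - Complex.normSq z))
    refine (lintegral_congr h3).trans ?_
    rw [lintegral_normSq_stdComplexGaussian (fun t => if 0 < s - t then
      ENNReal.ofReal (1 - Real.exp (-(s - t)) * expSum n (s - t)) else 0)]
    · split_ifs with hs
      · exact lintegral_exp_mul_gammaTail n hs
      · refine (setLIntegral_congr_fun measurableSet_Ioi (g := fun _ => 0) fun t ht => ?_).trans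
          (by simp)
        have : 0 < t := ht
        dsimp only
        rw [if_neg (by linarith), mul_zero]
    · have := continuous_expSum n
      exact Measurable.ite (measurableSet_lt measurable_const (by fun_prop)) (by fun_prop)
        measurable_const

/-- The squared norm of a complex Gaussian vector is Gamma distributed. -/
theorem complexGaussianVec_sum_normSq_lt {ι : Type*} [Fintype ι] [Nonempty ι] {s : ℝ}
    (hs : 0 ≤ s) :
    complexGaussianVec ι {z | ∑ i, Complex.normSq (z i) < s} =
      ENNReal.ofReal (gammaInc s (Fintype.card ι)) := by
  obtain ⟨n, hn⟩ := Nat.exists_eq_succ_of_ne_zero (Fintype.card_ne_zero (α := ι))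
  have e : Fin (n + 1) ≃ ι := (Fintype.equivFinOfCardEq hn).symm
  have hmp := measurePreserving_piCongrLeft (fun _ : ι => stdComplexGaussian) e
  have h1 := hmp.measure_preimage (measurableSet_lt (f := fun z : ι → ℂ =>
    ∑ i, Complex.normSq (z i)) (g := fun _ => s) measurable_sum_normSq
      measurable_const).nullMeasurableSet
  have h2 : (MeasurableEquiv.piCongrLeft (fun _ : ι => ℂ) e) ⁻¹'
      {z | ∑ i, Complex.normSq (z i) < s} = {z | ∑ i, Complex.normSq (z i) < s} := by
    ext z
    simp only [Set.mem_preimage, Set.mem_ofPred_eq]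
    rw [← e.sum_comp]
    simp [MeasurableEquiv.coe_piCongrLeft]
  have h3 := complexGaussianVec_fin_sum_normSq_lt (n + 1) s
  rw [complexGaussianVec, ← h1, h2]
  refine h3.trans ?_
  rw [hn, Nat.succ_eq_add_one, gammaInc_succ]
  split_ifs with h
  · rfl
  · obtain rfl : s = 0 := le_antisymm (not_lt.1 h) hs
    simp [expSum_succ_zero]

/-! ### Determinant inequality, rotations and zero-forcing projections -/

section Deterministic

open scoped ComplexOrder

/-- Fischer's inequality for splitting off one row and column of a positive definite matrix. -/
theorem det_le_apply_zero_mul_det {n : ℕ} {G : Matrix (Fin (n + 1)) (Fin (n + 1)) ℂ}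
    (hG : G.PosDef) : G.det ≤ G 0 0 * (G.submatrix Fin.succ Fin.succ).det := by
  have hD : (G.submatrix Fin.succ Fin.succ).PosDef := hG.submatrix (Fin.succ_injective n)
  let e : Fin n ⊕ Unit ≃ Fin (n + 1) :=
    ((finSuccEquiv n).trans (Equiv.optionEquivSumPUnit _)).symm
  have el : ∀ i, e (Sum.inl i) = i.succ := fun i => by simp [e]
  have er : ∀ i, e (Sum.inr i) = 0 := fun i => by simp [e]
  let B : Matrix (Fin n) Unit ℂ := Matrix.of fun i _ => G i.succ 0
  have hsub : G.submatrix e e = Matrix.fromBlocks (G.submatrix Fin.succ Fin.succ) B Bᴴ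
      (Matrix.of fun _ _ => G 0 0) := by
    ext i j
    rcases i with i | i <;> rcases j with j | j <;>
      simp [el, er, B, Matrix.fromBlocks, hG.isHermitian.apply]
  have := hD.isUnit.invertible
  -- The determinant is det D times the Schur complement G₀₀ - Bᴴ D⁻¹ B, which is at most G₀₀.
  rw [← Matrix.det_submatrix_equiv_self e G, hsub, Matrix.det_fromBlocks₁₁, mul_comm]
  refine mul_le_mul_of_nonneg_right ?_ hD.det_pos.le
  rw [Matrix.det_unique, Matrix.sub_apply]
  have hpsd := hD.inv.posSemidef.conjTranspose_mul_mul_same B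
  rw [Matrix.invOf_eq_nonsing_inv]
  exact sub_le_self _ hpsd.diag_nonneg

/-- The real number `det (I + ρ H Hᴴ)`. -/
noncomputable def gramDet {ι κ : Type*} [Fintype ι] [DecidableEq ι] [Fintype κ] (ρ : ℝ)
    (H : Matrix ι κ ℂ) : ℝ :=
  (Matrix.det (1 + (ρ : ℂ) • (H * Hᴴ))).re

variable {ι κ : Type*} [Fintype ι] [Fintype κ]

theorem posDef_one_add_smul_gram [DecidableEq κ] {ρ : ℝ} (hρ : 0 ≤ ρ) (H : Matrix ι κ ℂ) :
    (1 + (ρ : ℂ) • (Hᴴ * H)).PosDef :=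
  Matrix.PosDef.one.add_posSemidef
    ((Matrix.posSemidef_conjTranspose_mul_self H).smul (by exact_mod_cast hρ))

/-- Sylvester's identity moves to the column Gram matrix, whose diagonal carries the column norms
needed for Fischer's inequality. -/
theorem ofReal_gramDet [DecidableEq ι] [DecidableEq κ] {ρ : ℝ} (hρ : 0 ≤ ρ) (H : Matrix ι κ ℂ) :
    (gramDet ρ H : ℂ) = Matrix.det (1 + (ρ : ℂ) • (Hᴴ * H)) := by
  have h1 : Matrix.det (1 + (ρ : ℂ) • (H * Hᴴ)) = Matrix.det (1 + (ρ : ℂ) • (Hᴴ * H)) := by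
    rw [← Matrix.smul_mul, Matrix.det_one_add_mul_comm, Matrix.mul_smul]
  rw [gramDet, h1]
  have := (Complex.lt_def.1 (posDef_one_add_smul_gram hρ H).det_pos).2
  exact Complex.ext rfl (by simpa using this)

theorem gramDet_pos [DecidableEq ι] [DecidableEq κ] {ρ : ℝ} (hρ : 0 ≤ ρ) (H : Matrix ι κ ℂ) : 0 < gramDet ρ H := by
  have := (posDef_one_add_smul_gram hρ H).det_pos
  rw [← ofReal_gramDet hρ] at this
  exact_mod_cast this

theorem gramDet_of_isEmpty_left [DecidableEq ι] [IsEmpty ι] (ρ : ℝ) (H : Matrix ι κ ℂ) : gramDet ρ H = 1 := by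
  simp [gramDet]

theorem gramDet_of_isEmpty_right [DecidableEq ι] [IsEmpty κ] (ρ : ℝ) (H : Matrix ι κ ℂ) : gramDet ρ H = 1 := by
  have : H * Hᴴ = 0 := by ext; simp [Matrix.mul_apply]
  simp [gramDet, this]

theorem gramDet_mul_unitary [DecidableEq ι] [DecidableEq κ] (ρ : ℝ) (H : Matrix ι κ ℂ) {U : Matrix κ κ ℂ} (hU : Uᴴ * U = 1) :
    gramDet ρ (H * U) = gramDet ρ H := by
  have hU' : U * Uᴴ = 1 := mul_eq_one_comm.1 hU
  rw [gramDet, Matrix.conjTranspose_mul, Matrix.mul_assoc, ← Matrix.mul_assoc U, hU',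
    Matrix.one_mul, gramDet]

theorem continuous_gramDet [DecidableEq ι] (ρ : ℝ) : Continuous fun H : ι → κ → ℂ => gramDet ρ (Matrix.of H) := by
  unfold gramDet
  refine Complex.continuous_re.comp (Continuous.matrix_det ?_)
  have : Continuous fun H : ι → κ → ℂ => Matrix.of H := continuous_id
  exact continuous_const.add
    ((continuous_const_smul (ρ : ℂ)).comp (this.matrix_mul this.matrix_conjTranspose))

/-- The last n columns vanish in row 0, so deleting that row does not alter their Gram matrix;
Fischer's inequality splits off the first column. -/
theorem gramDet_le_of_row_zero {r n : ℕ} {ρ : ℝ} (hρ : 0 ≤ ρ)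
    (H : Matrix (Fin (r + 1)) (Fin (n + 1)) ℂ) (h0 : ∀ j : Fin n, H 0 j.succ = 0) :
    gramDet ρ H ≤ (1 + ρ * ∑ i, Complex.normSq (H i 0)) *
      gramDet ρ (H.submatrix Fin.succ Fin.succ) := by
  have key := det_le_apply_zero_mul_det (posDef_one_add_smul_gram hρ H)
  have h1 : (1 + (ρ : ℂ) • (Hᴴ * H)).submatrix Fin.succ Fin.succ =
      1 + (ρ : ℂ) • ((H.submatrix Fin.succ Fin.succ)ᴴ * H.submatrix Fin.succ Fin.succ) := by
    ext i j
    simp [Matrix.mul_apply, Fin.sum_univ_succ, h0, Matrix.one_apply]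
  have h2 : (1 + (ρ : ℂ) • (Hᴴ * H) : Matrix (Fin (n + 1)) (Fin (n + 1)) ℂ) 0 0 =
      ((1 + ρ * ∑ i, Complex.normSq (H i 0) : ℝ) : ℂ) := by
    simp [Matrix.mul_apply, Complex.normSq_eq_conj_mul_self]
  rw [h1, h2, ← ofReal_gramDet hρ, ← ofReal_gramDet hρ] at key
  exact_mod_cast key

theorem sum_normSq_vecMul_unitary [DecidableEq κ] (h : κ → ℂ) {U : Matrix κ κ ℂ} (hU : Uᴴ * U = 1) :
    ∑ j, Complex.normSq ((h ᵥ* U) j) = ∑ j, Complex.normSq (h j) := by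
  have hU' : (Uᵀ)ᴴ * Uᵀ = 1 := by
    have hU2 : U * Uᴴ = 1 := mul_eq_one_comm.1 hU
    have := congrArg Matrix.transpose hU2
    rwa [Matrix.transpose_mul, Matrix.transpose_one] at this
  have := sum_norm_sq_mulVec hU' h
  simpa [Matrix.mulVec_transpose, Complex.normSq_eq_norm_sq] using this

/-- A unitary matrix rotating a given row vector onto the first coordinate axis. -/
theorem exists_unitary_vecMul_eq_zero {n : ℕ} (h : Fin (n + 1) → ℂ) :
    ∃ U : Matrix (Fin (n + 1)) (Fin (n + 1)) ℂ, Uᴴ * U = 1 ∧ ∀ j : Fin n, (h ᵥ* U) j.succ = 0 := by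
  by_cases hh : h = 0
  · exact ⟨1, by simp, by simp [hh]⟩
  -- The conjugate makes ⟪v, b⟫ equal to the bilinear product of h and b, so basis vectors
  -- orthogonal to v give zero entries of h U.
  let v : EuclideanSpace ℂ (Fin (n + 1)) := WithLp.toLp 2 (star h)
  have hv : v ≠ 0 := fun h' => hh (star_eq_zero.1 (by
    have := congrArg WithLp.ofLp h'
    simpa [v] using this))
  obtain ⟨b, hb⟩ := Orthonormal.exists_orthonormalBasis_extension_of_card_eq (𝕜 := ℂ)
    (E := EuclideanSpace ℂ (Fin (n + 1))) (ι := Fin (n + 1)) (by simp)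
    (v := fun _ => (‖v‖⁻¹ : ℂ) • v) (s := {0}) (by
      constructor
      · rintro ⟨i, hi⟩
        simp [norm_smul, hv]
      · rintro ⟨i, hi⟩ ⟨j, hj⟩ hij
        exact absurd (Subtype.ext (hi.trans hj.symm)) hij)
  have hb0 := hb 0 rfl
  refine ⟨Matrix.of fun i j => b j i, ?_, fun j => ?_⟩
  · ext i j
    have := orthonormal_iff_ite.1 b.orthonormal i j
    rw [EuclideanSpace.inner_eq_star_dotProduct] at this
    rw [Matrix.one_apply, ← this]
    simp [Matrix.mul_apply, dotProduct, mul_comm]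
  · have h1 := orthonormal_iff_ite.1 b.orthonormal 0 j.succ
    rw [if_neg (Fin.succ_ne_zero j).symm, hb0, inner_smul_left] at h1
    have h2 := (mul_eq_zero.1 h1).resolve_left (by simpa using hv)
    rw [EuclideanSpace.inner_eq_star_dotProduct] at h2
    rw [← h2]
    simp [Matrix.vecMul, dotProduct, v, mul_comm]

/-- Every matrix with fewer rows than columns admits a zero-forcing precoder. -/
theorem exists_isZFPrecoder {N e : ℕ} (H : Matrix (Fin e) (Fin N) ℂ) :
    ∃ A : Matrix (Fin N) (Fin (N - e)) ℂ, IsZFPrecoder H A := by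
  let K : Submodule ℂ (EuclideanSpace ℂ (Fin N)) :=
    LinearMap.ker (Matrix.mulVecLin H ∘ₗ (WithLp.linearEquiv 2 ℂ (Fin N → ℂ)).toLinearMap)
  -- The kernel is larger when `H` is rank deficient; only N - e vectors of its basis are kept.
  have hK : N - e ≤ Module.finrank ℂ K := by
    have h1 := LinearMap.finrank_range_add_finrank_ker
      (Matrix.mulVecLin H ∘ₗ (WithLp.linearEquiv 2 ℂ (Fin N → ℂ)).toLinearMap)
    have h2 := Submodule.finrank_le (LinearMap.range
      (Matrix.mulVecLin H ∘ₗ (WithLp.linearEquiv 2 ℂ (Fin N → ℂ)).toLinearMap))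
    have h3 : Module.finrank ℂ (WithLp 2 (Fin N → ℂ)) = N := finrank_euclideanSpace_fin
    have h4 : Module.finrank ℂ (Fin e → ℂ) = e := by simp
    rw [h3] at h1
    rw [h4] at h2
    change _ + Module.finrank ℂ K = N at h1
    omega
  let b := stdOrthonormalBasis ℂ K
  refine ⟨Matrix.of fun i j => (b (Fin.castLE hK j) : EuclideanSpace ℂ (Fin N)) i, ?_, ?_⟩
  · ext i j
    have hmem : (Matrix.mulVecLin H ∘ₗ (WithLp.linearEquiv 2 ℂ (Fin N → ℂ)).toLinearMap)
        (b (Fin.castLE hK j)) = 0 := LinearMap.mem_ker.1 (b (Fin.castLE hK j)).2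
    have := congrFun hmem i
    simpa [-SetLike.coe_mem, -LinearMap.map_coe_ker, Matrix.mul_apply, Matrix.mulVec, dotProduct] using this
  · ext i j
    have := orthonormal_iff_ite.1 b.orthonormal (Fin.castLE hK i) (Fin.castLE hK j)
    rw [Submodule.coe_inner, EuclideanSpace.inner_eq_star_dotProduct] at this
    simp only [Fin.castLE_inj] at this
    rw [Matrix.one_apply, ← this]
    simp [Matrix.mul_apply, dotProduct, mul_comm]

/-- The orthogonal projection onto the null space of `H`, when `H` has full row rank. -/
noncomputable def nullProj {N e : ℕ} (H : Matrix (Fin e) (Fin N) ℂ) : Matrix (Fin N) (Fin N) ℂ :=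
  1 - Hᴴ * (H * Hᴴ)⁻¹ * H

/-- The difference Q of the two projections is Hermitian, and idempotent because it kills A and Hᴴ.
Its trace N - e - (N - e) is tr(Qᴴ Q) = 0, so Q = 0. -/
theorem IsZFPrecoder.mul_conjTranspose_eq {N e : ℕ} (heN : e ≤ N) {H : Matrix (Fin e) (Fin N) ℂ}
    {A : Matrix (Fin N) (Fin (N - e)) ℂ} (hA : IsZFPrecoder H A) (hH : IsUnit (H * Hᴴ).det) :
    A * Aᴴ = nullProj H := by
  set K := H * Hᴴ with hK
  set Q := 1 - Hᴴ * K⁻¹ * H - A * Aᴴ with hQ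
  have hKi : K * K⁻¹ = 1 := Matrix.mul_nonsing_inv _ hH
  have hKi' : K⁻¹ * K = 1 := Matrix.nonsing_inv_mul _ hH
  have hKh : Kᴴ = K := by simp [hK]
  have hAH : Aᴴ * Hᴴ = 0 := by
    rw [← Matrix.conjTranspose_mul, hA.null, Matrix.conjTranspose_zero]
  have hQh : Qᴴ = Q := by
    simp [hQ, Matrix.conjTranspose_nonsing_inv, hKh, Matrix.mul_assoc]
  have hQA : Q * A = 0 := by
    rw [hQ, Matrix.sub_mul, Matrix.sub_mul, Matrix.mul_assoc _ H A, hA.null,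
      Matrix.mul_assoc A, hA.orthonormal]
    simp
  have hQH : Q * Hᴴ = 0 := by
    rw [hQ, Matrix.sub_mul, Matrix.sub_mul, Matrix.mul_assoc _ H, ← hK, Matrix.mul_assoc _ _ K,
      hKi', Matrix.mul_assoc A, hAH]
    simp
  have hQQ : Q * Q = Q := by
    conv_lhs => rw [hQ, Matrix.mul_sub, Matrix.mul_sub, ← hQ]
    rw [← Matrix.mul_assoc Q A, hQA, ← Matrix.mul_assoc, ← Matrix.mul_assoc, hQH]
    simp
  have htr : Q.trace = 0 := by
    rw [hQ, Matrix.trace_sub, Matrix.trace_sub, Matrix.trace_mul_comm A, hA.orthonormal,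
      Matrix.trace_mul_comm _ H, ← Matrix.mul_assoc, ← hK, hKi]
    simp [Nat.cast_sub heN]
  have : Q = 0 := by
    rw [← Matrix.trace_conjTranspose_mul_self_eq_zero_iff, hQh, hQQ, htr]
  exact (sub_eq_zero.1 this).symm

end Deterministic

/-! ### Recursion for the determinant of a Gaussian matrix -/

theorem measurableSet_gramDet_le (r n : ℕ) (ρ T : ℝ) :
    MeasurableSet {H : Fin r → Fin n → ℂ | gramDet ρ (Matrix.of H) ≤ T} :=
  measurableSet_le (continuous_gramDet ρ).measurable measurable_const

theorem measurableSet_gramDet_lt (r n : ℕ) (ρ T : ℝ) :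
    MeasurableSet {H : Fin r → Fin n → ℂ | gramDet ρ (Matrix.of H) < T} :=
  measurableSet_lt (continuous_gramDet ρ).measurable measurable_const

/-- A Gaussian matrix splits into its first column and the remaining Gaussian matrix. -/
theorem measurePreserving_splitColumn (r n : ℕ) :
    MeasurePreserving (fun H : Fin r → Fin (n + 1) → ℂ =>
        ((fun i => H i 0, fun i j => H i j.succ) : (Fin r → ℂ) × (Fin r → Fin n → ℂ)))
      (complexGaussianMat (Fin r) (Fin (n + 1)))
      ((complexGaussianVec (Fin r)).prod (complexGaussianMat (Fin r) (Fin n))) := by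
  have h1 := measurePreserving_piFinSuccAbove (fun _ : Fin (n + 1) => stdComplexGaussian) 0
  have h2 := measurePreserving_pi (ι := Fin r) (fun _ => complexGaussianVec (Fin (n + 1)))
    (fun _ => stdComplexGaussian.prod (complexGaussianVec (Fin n))) (fun _ => h1)
  exact (measurePreserving_arrowProdEquivProdArrow ℂ (Fin n → ℂ) (Fin r)
    (fun _ => stdComplexGaussian) (fun _ => complexGaussianVec (Fin n))).comp h2

theorem measurePreserving_consRow (r n : ℕ) :
    MeasurePreserving (fun p : (Fin n → ℂ) × (Fin r → Fin n → ℂ) =>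
        (Fin.cons p.1 p.2 : Fin (r + 1) → Fin n → ℂ))
      ((complexGaussianVec (Fin n)).prod (complexGaussianMat (Fin r) (Fin n)))
      (complexGaussianMat (Fin (r + 1)) (Fin n)) := by
  have h := (measurePreserving_piFinSuccAbove
    (fun _ : Fin (r + 1) => complexGaussianVec (Fin n)) 0).symm
  convert h using 1
  · ext p : 1
    simp [MeasurableEquiv.piFinSuccAbove, Fin.consEquiv]
  · rfl
  · rfl

/-- With the first row h frozen, h is rotated onto the first axis without changing the law of the
other rows. Their first column v and the remaining block are independent, and 1 + ρ(‖h‖² + ‖v‖²) < s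
with det' ≤ T forces det < s T. -/
theorem complexGaussianMat_cons_gramDet_lt_ge {r n : ℕ} {ρ s T : ℝ} (hρ : 0 < ρ) (hs : 0 < s)
    (h : Fin (n + 1) → ℂ) :
    complexGaussianVec (Fin r)
        {v | ∑ i, Complex.normSq (h i) + ∑ i, Complex.normSq (v i) < (s - 1) / ρ} *
      complexGaussianMat (Fin r) (Fin n) {H | gramDet ρ (Matrix.of H) ≤ T} ≤
    complexGaussianMat (Fin r) (Fin (n + 1))
      {H | gramDet ρ (Matrix.of (Fin.cons h H : Fin (r + 1) → Fin (n + 1) → ℂ)) < s * T} := by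
  obtain ⟨U, hU, hU0⟩ := exists_unitary_vecMul_eq_zero h
  have hcons : Measurable fun H : Fin r → Fin (n + 1) → ℂ =>
      (Fin.cons (h ᵥ* U) H : Fin (r + 1) → Fin (n + 1) → ℂ) :=
    (measurePreserving_consRow r (n + 1)).measurable.comp measurable_prodMk_left
  have hrot : complexGaussianMat (Fin r) (Fin (n + 1))
      {H | gramDet ρ (Matrix.of (Fin.cons h H : Fin (r + 1) → Fin (n + 1) → ℂ)) < s * T} =
      complexGaussianMat (Fin r) (Fin (n + 1)) {H | gramDet ρ
        (Matrix.of (Fin.cons (h ᵥ* U) H : Fin (r + 1) → Fin (n + 1) → ℂ)) < s * T} := by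
    have hm : MeasurableSet {H : Fin r → Fin (n + 1) → ℂ | gramDet ρ
        (Matrix.of (Fin.cons (h ᵥ* U) H : Fin (r + 1) → Fin (n + 1) → ℂ)) < s * T} :=
      hcons (measurableSet_gramDet_lt _ _ ρ (s * T))
    rw [← (measurePreserving_matMul (r := Fin r) hU).measure_preimage hm.nullMeasurableSet]
    congr 1
    ext H
    simp only [Set.mem_ofPred_eq, Set.mem_preimage]
    rw [← gramDet_mul_unitary ρ _ hU]
    have : (Matrix.of (Fin.cons h H : Fin (r + 1) → Fin (n + 1) → ℂ)) * U =
        Matrix.of (Fin.cons (h ᵥ* U) (fun i => H i ᵥ* U) : Fin (r + 1) → Fin (n + 1) → ℂ) := by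
      ext i j
      refine Fin.cases ?_ (fun i => ?_) i <;> simp [Matrix.mul_apply, Matrix.vecMul, dotProduct]
    rw [this]
  rw [hrot, ← Measure.prod_prod]
  refine ((measurePreserving_splitColumn r n).measure_preimage
    ((measurableSet_lt (by have := measurable_sum_normSq (ι := Fin r); fun_prop)
      measurable_const).prod (measurableSet_gramDet_le r n ρ T)).nullMeasurableSet).symm.le.trans
    (measure_mono fun H hH => ?_)
  obtain ⟨h1, h2⟩ := hH
  simp only [Set.mem_ofPred_eq] at h1 h2 ⊢
  refine (gramDet_le_of_row_zero hρ.le _ (by simpa using hU0)).trans_lt ?_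
  have h3 : ∑ i, Complex.normSq ((h ᵥ* U) i) = Complex.normSq ((h ᵥ* U) 0) := by
    rw [Fin.sum_univ_succ]
    simp [hU0]
  rw [← sum_normSq_vecMul_unitary h hU, h3, lt_div_iff₀ hρ] at h1
  have hpos : 0 < gramDet ρ (Matrix.of fun i j => H i (Fin.succ j)) := gramDet_pos hρ.le _
  refine lt_of_lt_of_le (mul_lt_mul_of_pos_right (c := s) ?_ hpos)
    (mul_le_mul_of_nonneg_left h2 hs.le)
  rw [Fin.sum_univ_succ]
  simp only [Matrix.of_apply, Fin.cons_zero, Fin.cons_succ]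
  linarith

theorem complexGaussianVec_prod_sum_normSq_lt (n r : ℕ) {c : ℝ} (hc : 0 ≤ c) :
    ((complexGaussianVec (Fin (n + 1))).prod (complexGaussianVec (Fin r)))
      {p | ∑ i, Complex.normSq (p.1 i) + ∑ i, Complex.normSq (p.2 i) < c} =
      ENNReal.ofReal (gammaInc c (n + 1 + r)) := by
  have h1 := complexGaussianVec_sum_normSq_lt (ι := Fin (n + 1) ⊕ Fin r) hc
  have h2 := measurePreserving_sumPiEquivProdPi
    (fun _ : Fin (n + 1) ⊕ Fin r => stdComplexGaussian)
  rw [Fintype.card_sum, Fintype.card_fin, Fintype.card_fin] at h1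
  have h3 : MeasurableSet {p : (Fin (n + 1) → ℂ) × (Fin r → ℂ) |
      ∑ i, Complex.normSq (p.1 i) + ∑ i, Complex.normSq (p.2 i) < c} := by
    have := measurable_sum_normSq (ι := Fin r)
    have := measurable_sum_normSq (ι := Fin (n + 1))
    exact measurableSet_lt (by fun_prop) measurable_const
  rw [← h1, complexGaussianVec, complexGaussianVec, complexGaussianVec,
    ← h2.measure_preimage h3.nullMeasurableSet]
  congr 1
  ext z
  simp [MeasurableEquiv.sumPiEquivProdPi]

theorem gammaInc_mul_gramDet_le {r n : ℕ} {ρ s T : ℝ} (hρ : 0 < ρ) (hs : 1 ≤ s) :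
    ENNReal.ofReal (gammaInc ((s - 1) / ρ) (n + 1 + r)) *
      complexGaussianMat (Fin r) (Fin n) {H | gramDet ρ (Matrix.of H) ≤ T} ≤
    complexGaussianMat (Fin (r + 1)) (Fin (n + 1)) {H | gramDet ρ (Matrix.of H) < s * T} := by
  have hm := measurableSet_gramDet_lt (r + 1) (n + 1) ρ (s * T)
  have hcons := measurePreserving_consRow r (n + 1)
  have h3 : MeasurableSet {p : (Fin (n + 1) → ℂ) × (Fin r → ℂ) |
      ∑ i, Complex.normSq (p.1 i) + ∑ i, Complex.normSq (p.2 i) < (s - 1) / ρ} := by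
    have := measurable_sum_normSq (ι := Fin r)
    have := measurable_sum_normSq (ι := Fin (n + 1))
    exact measurableSet_lt (by fun_prop) measurable_const
  rw [← hcons.measure_preimage hm.nullMeasurableSet, Measure.prod_apply (hcons.measurable hm),
    ← complexGaussianVec_prod_sum_normSq_lt n r (div_nonneg (sub_nonneg.2 hs) hρ.le),
    Measure.prod_apply h3, ← lintegral_mul_const _ (measurable_measure_prodMk_left h3)]
  exact lintegral_mono fun h =>
    complexGaussianMat_cons_gramDet_lt_ge (r := r) (T := T) hρ (zero_lt_one.trans_le hs) h

/-- The weak inequality lets the induction start: for an empty matrix the determinant and the empty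
product are both 1. -/
theorem prod_gammaInc_le_gramDet_le {ρ : ℝ} (hρ : 0 < ρ) (r n : ℕ) (t : ℕ → ℝ)
    (ht : ∀ l < min r n, 1 ≤ t l) :
    ∏ l ∈ Finset.range (min r n),
        ENNReal.ofReal (gammaInc ((t l - 1) / ρ) (r + n - 2 * l - 1)) ≤
      complexGaussianMat (Fin r) (Fin n)
        {H | gramDet ρ (Matrix.of H) ≤ ∏ l ∈ Finset.range (min r n), t l} := by
  induction r generalizing n t with
  | zero => simp [gramDet_of_isEmpty_left]
  | succ r ih =>
    cases n with
    | zero => simp [gramDet_of_isEmpty_right]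
    | succ n =>
      have ih' := ih n (fun l => t (l + 1)) fun l hl => ht (l + 1) (by omega)
      rw [Nat.succ_min_succ, Finset.prod_range_succ', Finset.prod_range_succ', mul_comm,
        mul_comm _ (t 0)]
      have e0 : r + 1 + (n + 1) - 2 * 0 - 1 = n + 1 + r := by omega
      have e1 : ∀ l, r + 1 + (n + 1) - 2 * (l + 1) - 1 = r + n - 2 * l - 1 := by omega
      simp only [e0, e1]
      refine (mul_le_mul_right ih' _).trans ((gammaInc_mul_gramDet_le hρ (ht 0 (by omega))).trans
        (measure_mono (Set.ofPred_subset_ofPred.2 fun _ => le_of_lt)))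

/-- The outage probability of a Gaussian channel matrix is at least the product of the
distribution functions of independent Gamma variables. -/
theorem prod_gammaInc_le_gramDet_lt {ρ : ℝ} (hρ : 0 < ρ) {r n : ℕ} (hr : 0 < r) (hn : 0 < n)
    (t : ℕ → ℝ) (ht : ∀ l < min r n, 1 ≤ t l) :
    ∏ l ∈ Finset.range (min r n),
        ENNReal.ofReal (gammaInc ((t l - 1) / ρ) (r + n - 2 * l - 1)) ≤
      complexGaussianMat (Fin r) (Fin n)
        {H | gramDet ρ (Matrix.of H) < ∏ l ∈ Finset.range (min r n), t l} := by
  obtain ⟨r, rfl⟩ := Nat.exists_eq_succ_of_ne_zero hr.ne'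
  obtain ⟨n, rfl⟩ := Nat.exists_eq_succ_of_ne_zero hn.ne'
  -- The outermost recursion step is done separately, since it turns the weak inequality into a
  -- strict one.
  have h := prod_gammaInc_le_gramDet_le hρ r n (fun l => t (l + 1)) fun l hl =>
    ht (l + 1) (by omega)
  rw [Nat.succ_min_succ, Finset.prod_range_succ', Finset.prod_range_succ', mul_comm,
    mul_comm _ (t 0)]
  have e0 : r.succ + n.succ - 2 * 0 - 1 = n + 1 + r := by omega
  have e1 : ∀ l, r.succ + n.succ - 2 * (l + 1) - 1 = r + n - 2 * l - 1 := by omega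
  simp only [e0, e1]
  exact (mul_le_mul_right h _).trans (gammaInc_mul_gramDet_le hρ (ht 0 (by omega)))

/-! ### Almost sure full rank -/

theorem complexGaussianVec_singleton_zero {ι : Type*} [Fintype ι] [Nonempty ι] :
    complexGaussianVec ι {0} = 0 := by
  have h := @complexGaussianVec_sum_normSq_lt ι _ _
  obtain ⟨n, hn⟩ := Nat.exists_eq_succ_of_ne_zero (Fintype.card_ne_zero (α := ι))
  simp only [hn, Nat.succ_eq_add_one, gammaInc_succ] at h
  have hc : Continuous fun s => ENNReal.ofReal (1 - Real.exp (-s) * expSum (n + 1) s) := by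
    have := continuous_expSum (n + 1)
    exact ENNReal.continuous_ofReal.comp (by fun_prop)
  have hlim := (hc.tendsto 0).mono_left (nhdsWithin_le_nhds (s := Set.Ioi 0))
  simp only [expSum_succ_zero, neg_zero, Real.exp_zero, mul_one, sub_self,
    ENNReal.ofReal_zero] at hlim
  refine le_antisymm (ge_of_tendsto hlim ?_) zero_le
  filter_upwards [self_mem_nhdsWithin] with s hs
  have hs : 0 < s := hs
  rw [← h hs.le]
  exact measure_mono (by simpa using hs)

/-- A Gaussian vector almost surely avoids a given span of too few vectors. -/
theorem complexGaussianVec_span_eq_zero {N e : ℕ} (he : e < N) (v : Fin e → Fin N → ℂ) :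
    complexGaussianVec (Fin N) {x | x ∈ Submodule.span ℂ (Set.range v)} = 0 := by
  -- Multiplication by A kills the span but maps the Gaussian law to a Gaussian law on ℂ^(N - e),
  -- which has no atom at 0.
  obtain ⟨A, hA⟩ := exists_isZFPrecoder (Matrix.of v)
  have : Nonempty (Fin (N - e)) := ⟨⟨0, by omega⟩⟩
  have h := complexGaussianVec_singleton_zero (ι := Fin (N - e))
  rw [← complexGaussianVec_map_vecMul hA.orthonormal,
    Measure.map_apply (measurable_vecMul A) (measurableSet_singleton 0)] at h
  refine measure_mono_null (fun x hx => ?_) h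
  have hle : Submodule.span ℂ (Set.range v) ≤ LinearMap.ker (Matrix.vecMulLinear A) := by
    rw [Submodule.span_le]
    rintro _ ⟨i, rfl⟩
    have := congrFun hA.null i
    exact this
  exact hle hx

theorem ae_linearIndependent {N e : ℕ} (he : e ≤ N) :
    ∀ᵐ H ∂complexGaussianMat (Fin e) (Fin N), LinearIndependent ℂ H := by
  induction e with
  | zero => exact Filter.Eventually.of_forall fun H => linearIndependent_empty_type
  | succ e ih =>
    have hcons := measurePreserving_consRow e N
    rw [← hcons.map_eq, ae_map_iff hcons.measurable.aemeasurable
      (isOpen_setOfPred_linearIndependent (𝕜 := ℂ)).measurableSet]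
    have hms : MeasurableSet {p : (Fin N → ℂ) × (Fin e → Fin N → ℂ) |
        ¬ LinearIndependent ℂ (Fin.cons p.1 p.2 : Fin (e + 1) → Fin N → ℂ)} :=
      (hcons.measurable (isOpen_setOfPred_linearIndependent (𝕜 := ℂ)).measurableSet).compl
    rw [ae_iff, Measure.prod_apply_symm hms]
    refine (lintegral_congr_ae (g := fun _ => 0) ?_).trans (by simp)
    filter_upwards [ih (by omega)] with v hv
    refine measure_mono_null (fun x hx => ?_) (complexGaussianVec_span_eq_zero he v)
    have hx : ¬ LinearIndependent ℂ (Fin.cons x v : Fin (e + 1) → Fin N → ℂ) := hx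
    rw [linearIndependent_finCons] at hx
    simpa [hv] using hx

theorem ae_isUnit_det_mul_conjTranspose {N e : ℕ} (he : e ≤ N) :
    ∀ᵐ H ∂complexGaussianMat (Fin e) (Fin N), IsUnit (Matrix.of H * (Matrix.of H)ᴴ).det := by
  open scoped ComplexOrder in
  filter_upwards [ae_linearIndependent he] with H hH
  have h := Matrix.PosDef.mul_conjTranspose_self (Matrix.of H)
    (Matrix.vecMul_injective_iff.2 hH)
  exact h.det_pos.ne'.isUnit

/-! ### Joint law of the channels and reduction by zero forcing -/

theorem measurePreserving_curry (ι κ : Type*) [Fintype ι] [Fintype κ] :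
    MeasurePreserving (MeasurableEquiv.curry ι κ ℂ)
      (Measure.pi fun _ : ι × κ => stdComplexGaussian) (complexGaussianMat ι κ) := by
  refine ⟨MeasurableEquiv.measurable _, ?_⟩
  simp only [complexGaussianMat, complexGaussianVec, ← Measure.infinitePi_eq_pi]
  exact Measure.infinitePi_map_curry fun _ _ => stdComplexGaussian

/-- The joint law of the two channels under Rayleigh fading. -/
theorem IsRayleighFading.hasLaw {Ω : Type*} [MeasurableSpace Ω] {P : Measure Ω} {Nt Nm Ne : ℕ}
    {Hm : Ω → Matrix (Fin Nm) (Fin Nt) ℂ} {He : Ω → Matrix (Fin Ne) (Fin Nt) ℂ}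
    (hH : IsRayleighFading P Hm He) :
    HasLaw (fun ω => ((fun i j => Hm ω i j, fun i j => He ω i j) :
        (Fin Nm → Fin Nt → ℂ) × (Fin Ne → Fin Nt → ℂ)))
      ((complexGaussianMat (Fin Nm) (Fin Nt)).prod (complexGaussianMat (Fin Ne) (Fin Nt))) P := by
  have hlaw : ∀ x : (Fin Nm ⊕ Fin Ne) × Fin Nt, HasLaw (fun ω =>
      Sum.elim (fun i => Hm ω i x.2) (fun i => He ω i x.2) x.1) stdComplexGaussian P := by
    rintro ⟨i | i, j⟩
    exacts [hH.law_main i j, hH.law_eve i j]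
  have hX := hH.indep.map_fun_eq_pi_map fun x => (hlaw x).aemeasurable
  simp only [(hlaw _).map_eq] at hX
  have hΨ := (measurePreserving_sumPiEquivProdPi
    (fun _ : Fin Nm ⊕ Fin Ne => complexGaussianVec (Fin Nt))).comp
      (measurePreserving_curry (Fin Nm ⊕ Fin Ne) (Fin Nt))
  have hXm := aemeasurable_pi_lambda _ fun x => (hlaw x).aemeasurable
  refine ⟨hΨ.measurable.comp_aemeasurable hXm, ?_⟩
  have h := AEMeasurable.map_map_of_aemeasurable hΨ.measurable.aemeasurable hXm
  rw [hX, hΨ.map_eq] at h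
  exact h.symm

/-- The real number `det (I + ρ H Π Hᴴ)`, where `Π` projects onto the null space of `K`. -/
noncomputable def nullGramDet {Nt Nm Ne : ℕ} (ρ : ℝ)
    (p : (Fin Nm → Fin Nt → ℂ) × (Fin Ne → Fin Nt → ℂ)) : ℝ :=
  (Matrix.det (1 + (ρ : ℂ) •
    (Matrix.of p.1 * nullProj (Matrix.of p.2) * (Matrix.of p.1)ᴴ))).re

theorem IsZFPrecoder.gramDet_mul_eq {Nt Nm Ne : ℕ} (hle : Ne ≤ Nt) (ρ : ℝ)
    (Hm : Fin Nm → Fin Nt → ℂ) {He : Fin Ne → Fin Nt → ℂ} {A : Matrix (Fin Nt) (Fin (Nt - Ne)) ℂ}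
    (hA : IsZFPrecoder (Matrix.of He) A)
    (hHe : IsUnit (Matrix.of He * (Matrix.of He)ᴴ).det) :
    gramDet ρ (Matrix.of Hm * A) = nullGramDet ρ (Hm, He) := by
  rw [gramDet, nullGramDet, ← hA.mul_conjTranspose_eq hle hHe, Matrix.conjTranspose_mul]
  simp only [Matrix.mul_assoc]

theorem measurable_nullProj (N e : ℕ) :
    Measurable fun H : Fin e → Fin N → ℂ => fun i j => nullProj (Matrix.of H) i j := by
  refine measurable_pi_iff.2 fun i => measurable_pi_iff.2 fun j => ?_
  have hof : Continuous fun H : Fin e → Fin N → ℂ => Matrix.of H := continuous_id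
  have hK := hof.matrix_mul hof.matrix_conjTranspose
  have hadj := (hof.matrix_conjTranspose.matrix_mul hK.matrix_adjugate).matrix_mul hof
  -- Writing the inverse as adjugate over determinant gives measurability everywhere, including at
  -- singular Gram matrices.
  have h : ∀ H : Fin e → Fin N → ℂ, nullProj (Matrix.of H) i j = (1 : Matrix _ _ ℂ) i j -
      ((Matrix.of H * (Matrix.of H)ᴴ).det)⁻¹ * ((Matrix.of H)ᴴ *
        (Matrix.of H * (Matrix.of H)ᴴ).adjugate * Matrix.of H) i j := by
    intro H
    simp [nullProj, Matrix.inv_def, Ring.inverse_eq_inv']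
  simp_rw [h]
  exact measurable_const.sub (hK.matrix_det.measurable.inv.mul (hadj.matrix_elem i j).measurable)

theorem measurable_nullGramDet (Nt Nm Ne : ℕ) (ρ : ℝ) :
    Measurable (nullGramDet (Nt := Nt) (Nm := Nm) (Ne := Ne) ρ) := by
  have hc : Continuous fun p : (Fin Nm → Fin Nt → ℂ) × (Fin Nt → Fin Nt → ℂ) =>
      (Matrix.det (1 + (ρ : ℂ) • (Matrix.of p.1 * Matrix.of p.2 * (Matrix.of p.1)ᴴ))).re := by
    have h1 : Continuous fun p : (Fin Nm → Fin Nt → ℂ) × (Fin Nt → Fin Nt → ℂ) =>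
      Matrix.of p.1 := continuous_fst
    have h2 : Continuous fun p : (Fin Nm → Fin Nt → ℂ) × (Fin Nt → Fin Nt → ℂ) =>
      Matrix.of p.2 := continuous_snd
    exact Complex.continuous_re.comp (Continuous.matrix_det (continuous_const.add
      ((continuous_const_smul (ρ : ℂ)).comp
        ((h1.matrix_mul h2).matrix_mul h1.matrix_conjTranspose))))
  have hpair : Measurable fun p : (Fin Nm → Fin Nt → ℂ) × (Fin Ne → Fin Nt → ℂ) =>
      (p.1, fun i j => nullProj (Matrix.of p.2) i j) :=
    measurable_fst.prodMk ((measurable_nullProj Nt Ne).comp measurable_snd)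
  have h := hc.measurable.comp hpair
  have hof : ∀ K : Fin Ne → Fin Nt → ℂ,
    Matrix.of (fun i j => nullProj (Matrix.of K) i j) = nullProj (Matrix.of K) := fun _ => rfl
  simp only [Function.comp_def, hof] at h
  exact h

/-- Zero forcing turns the two independent channels into a Gaussian channel with `Nt - Ne`
transmit antennas. -/
theorem complexGaussianMat_gramDet_lt_eq {Nt Nm Ne : ℕ} (hle : Ne ≤ Nt) (ρ T : ℝ) :
    ((complexGaussianMat (Fin Nm) (Fin Nt)).prod (complexGaussianMat (Fin Ne) (Fin Nt)))
      {p | nullGramDet ρ p < T} =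
    complexGaussianMat (Fin Nm) (Fin (Nt - Ne)) {H | gramDet ρ (Matrix.of H) < T} := by
  rw [Measure.prod_apply_symm
    (measurableSet_lt (measurable_nullGramDet Nt Nm Ne ρ) measurable_const)]
  refine (lintegral_congr_ae (g := fun _ => complexGaussianMat (Fin Nm) (Fin (Nt - Ne))
    {H | gramDet ρ (Matrix.of H) < T}) ?_).trans (by simp)
  filter_upwards [ae_isUnit_det_mul_conjTranspose hle] with He hHe
  -- `He` is fixed here, so the precoder can be chosen pointwise, with no measurability in `He`.
  obtain ⟨A, hA⟩ := exists_isZFPrecoder (Matrix.of He)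
  rw [← (measurePreserving_matMul (r := Fin Nm) hA.orthonormal).measure_preimage
    (measurableSet_gramDet_lt Nm (Nt - Ne) ρ T).nullMeasurableSet]
  congr 1
  ext Hm
  simp only [Set.mem_preimage, Set.mem_ofPred_eq]
  rw [← hA.gramDet_mul_eq hle ρ Hm hHe]
  rfl

/-! ### Assembly of the outage bound -/

theorem gammaInc_nonneg {x : ℝ} (hx : 0 ≤ x) (n : ℕ) : 0 ≤ gammaInc x n := by
  refine mul_nonneg (by positivity) (intervalIntegral.integral_nonneg hx fun t ht => ?_)
  have := ht.1
  positivity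

theorem prod_rpow_eq_exp_secrecyRate {g η : ℝ} (hgη : 0 < 1 + g * η) (s : Finset ℕ) (a : ℕ → ℝ) :
    ∏ l ∈ s, (1 + g * η) ^ a l = Real.exp (secrecyRate g η (∑ l ∈ s, a l)) := by
  rw [secrecyRate, Finset.sum_mul, Real.exp_sum]
  exact Finset.prod_congr rfl fun l _ => by rw [Real.rpow_def_of_pos hgη, mul_comm]

theorem arrayGain_nonneg {Ω : Type*} [MeasurableSpace Ω] (P : Measure Ω) {Nt Nm Ne : ℕ}
    (Hm : Ω → Matrix (Fin Nm) (Fin Nt) ℂ) (He : Ω → Matrix (Fin Ne) (Fin Nt) ℂ) :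
    0 ≤ arrayGain P Hm He :=
  integral_nonneg fun _ => le_max_right _ _

/-- `A` need not be measurable, so neither need the outage event be; an almost sure inclusion of the
event stated through `nullGramDet` suffices. -/
theorem IsRayleighFading.measure_mutualInfo_lt_ge {Ω : Type*} [MeasurableSpace Ω] {P : Measure Ω}
    {Nt Nm Ne : ℕ} (hNe : Ne < Nt)
    {Hm : Ω → Matrix (Fin Nm) (Fin Nt) ℂ} {He : Ω → Matrix (Fin Ne) (Fin Nt) ℂ}
    (hH : IsRayleighFading P Hm He) {A : Ω → Matrix (Fin Nt) (Fin (Nt - Ne)) ℂ}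
    (hA : ∀ᵐ ω ∂P, IsZFPrecoder (He ω) (A ω)) {η : ℝ} (hη : 0 < η) (R : ℝ) :
    complexGaussianMat (Fin Nm) (Fin (Nt - Ne))
      {H | gramDet (η / (Nt - Ne : ℕ)) (Matrix.of H) < Real.exp R} ≤
    P {ω | mutualInfo η (Hm ω * A ω) < R} := by
  have hρ : 0 ≤ η / (Nt - Ne : ℕ) := by positivity
  have hlaw := hH.hasLaw
  have hms : MeasurableSet {p : (Fin Nm → Fin Nt → ℂ) × (Fin Ne → Fin Nt → ℂ) |
      nullGramDet (η / (Nt - Ne : ℕ)) p < Real.exp R} :=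
    measurableSet_lt (measurable_nullGramDet Nt Nm Ne _) measurable_const
  rw [← complexGaussianMat_gramDet_lt_eq hNe.le, ← hlaw.map_eq,
    Measure.map_apply_of_aemeasurable hlaw.aemeasurable hms]
  have hfull : ∀ᵐ p ∂P.map (fun ω => ((fun i j => Hm ω i j, fun i j => He ω i j) :
      (Fin Nm → Fin Nt → ℂ) × (Fin Ne → Fin Nt → ℂ))),
      IsUnit (Matrix.of p.2 * (Matrix.of p.2)ᴴ).det := by
    rw [hlaw.map_eq]
    exact Measure.quasiMeasurePreserving_snd.ae (ae_isUnit_det_mul_conjTranspose hNe.le)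
  refine measure_mono_ae ?_
  filter_upwards [ae_of_ae_map hlaw.aemeasurable hfull, hA] with ω hω hAω hlt
  have hlt : nullGramDet (η / (Nt - Ne : ℕ)) (fun i j => Hm ω i j, fun i j => He ω i j) <
    Real.exp R := hlt
  rw [← IsZFPrecoder.gramDet_mul_eq hNe.le _ _ hAω hω] at hlt
  exact (Real.log_lt_iff_lt_exp (gramDet_pos hρ (Hm ω * A ω))).2 hlt

end ZFSecrecy

theorem theorem2 {Ω : Type*} [MeasurableSpace Ω] (P : Measure Ω) [IsProbabilityMeasure P]
    (Nt Nm Ne : ℕ) (hNe : Ne < Nt) (hNm : 0 < Nm)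
    (Hm : Ω → Matrix (Fin Nm) (Fin Nt) ℂ) (He : Ω → Matrix (Fin Ne) (Fin Nt) ℂ)
    (hH : ZFSecrecy.IsRayleighFading P Hm He)
    (A : Ω → Matrix (Fin Nt) (Fin (Nt - Ne)) ℂ)
    (hA : ∀ᵐ ω ∂P, ZFSecrecy.IsZFPrecoder (He ω) (A ω))
    (m k : ℕ) (hm : m = min (Nt - Ne) Nm) (hk : k = max (Nt - Ne) Nm)
    (η : ℝ) (hη : 0 < η) :
    0 ≤ ZFSecrecy.arrayGain P Hm He ∧
    ∀ g : ℝ, 0 ≤ g →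
      ∀ (rs : ℝ) (a : ℕ → ℝ),
        (∀ l ∈ Finset.Icc 1 m, 0 ≤ a l) → AntitoneOn a (Set.Icc 1 m) →
        rs = ∑ l ∈ Finset.Icc 1 m, a l →
          ∏ l ∈ Finset.Icc 1 m,
              ZFSecrecy.gammaInc (ZFSecrecy.xi Nt Ne g η (a l)) (k + m - 2 * l + 1)
            ≤ ZFSecrecy.outageZF P Hm A η (ZFSecrecy.secrecyRate g η rs) := by
  open ZFSecrecy in
  refine ⟨arrayGain_nonneg P Hm He, fun g hg rs a ha _ hrs => ?_⟩
  have hn : 0 < Nt - Ne := by omega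
  have hn' : (0 : ℝ) < (Nt - Ne : ℕ) := by exact_mod_cast hn
  have hgη : 1 ≤ 1 + g * η := le_add_of_nonneg_right (mul_nonneg hg hη.le)
  have hxi : ∀ x, xi Nt Ne g η x = ((1 + g * η) ^ x - 1) / (η / (Nt - Ne : ℕ)) := by
    intro x
    rw [xi, ← Nat.cast_sub hNe.le]
    field_simp
  have hone : ∀ l ∈ Finset.Icc 1 m, 1 ≤ (1 + g * η) ^ a l := fun l hl =>
    Real.one_le_rpow hgη (ha l hl)
  have hIcc : Finset.Icc 1 m = Finset.Ico 1 (m + 1) := by ext; simp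
  have hbound := prod_gammaInc_le_gramDet_lt (ρ := η / (Nt - Ne : ℕ)) (by positivity) hNm hn
    (fun i => (1 + g * η) ^ a (1 + i)) fun i hi => hone _ (by simp; omega)
  rw [min_comm, ← hm, ← Nat.add_sub_cancel (n := m) (m := 1),
    ← Finset.prod_Ico_eq_prod_range (fun l => (1 + g * η) ^ a l), Nat.add_sub_cancel, ← hIcc,
    prod_rpow_eq_exp_secrecyRate (by linarith), ← hrs] at hbound
  have hprod : ENNReal.ofReal (∏ l ∈ Finset.Icc 1 m,
      gammaInc (xi Nt Ne g η (a l)) (k + m - 2 * l + 1)) =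
      ∏ i ∈ Finset.range m, ENNReal.ofReal (gammaInc
        (((1 + g * η) ^ a (1 + i) - 1) / (η / (Nt - Ne : ℕ))) (Nm + (Nt - Ne) - 2 * i - 1)) := by
    rw [ENNReal.ofReal_prod_of_nonneg, hIcc, Finset.prod_Ico_eq_prod_range, Nat.add_sub_cancel]
    · refine Finset.prod_congr rfl fun i hi => ?_
      -- With l = i + 1 and k + m = Nm + (Nt - Ne) the parameters agree; i < m keeps the natural
      -- subtractions from truncating.
      have := Finset.mem_range.1 hi
      rw [hxi]
      congr 2
      omega
    · intro l hl
      rw [hxi]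
      exact gammaInc_nonneg (div_nonneg (sub_nonneg.2 (hone l hl)) (by positivity)) _
  rw [outageZF, Measure.real, ← ENNReal.ofReal_le_iff_le_toReal (measure_ne_top _ _), hprod]
  exact hbound.trans (hH.measure_mutualInfo_lt_ge hNe hA hη _)
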